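/- Let $\mathbf C$ be a small category with countably many arrows and $O$ a set. A *$\Gamma(\mathbf C)$-algebra* $\mathbb X$ is a functor $\mathbf C\to\mathbf{Set}$: a family of sets $(X_i)_{i\in|\mathbf C|}$ with functions $c_{\mathbb X}:X_i\to X_j$ for $c\in\mathbf C[i,j]$, compatible with identities and composition; homomorphisms are natural transformations. Put $\int X=\sum_i X_i$, and write $c;d$ for "first $c$, then $d$". *The functor $\mathbf{PDA}$.* The set of elements of sort $i$ of $\mathbf{PDA}(\mathbb X)$ is the set of countable sets of triples $(c,o,q)$, where $c$ is an arrow of $\mathbf C$ with source $i$, $o\in O$ and $q\in\int X$. For $d:i\to k$, $d_{\mathbf{PDA}(\mathbb X)}(A)=\{(c_2,o,q)\mid (d;c_2,o,q)\in A\}$. On homomorphisms, $\mathbf{PDA}(h)(A)=\{(c,o,h(q))\mid (c,o,q)\in A\}$. *Inference systems.* An inference system $T$ is a set of rules $c\Rightarrow^{o}_{o'}d$, where $c,d$ are arrows of $\mathbf C$ and $o,o'\in O$. Let $\Phi(T)$ be the smallest set of rules that contains $T$ and all $id_i\Rightarrow^{o}_{o}id_j$, and contains $c;d\Rightarrow^{o}_{o''}c';d'$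 whenever it contains $c\Rightarrow^{o}_{o'}c'$ and $d\Rightarrow^{o'}_{o''}d'$ and both composites are defined. For $d:i\to k$ write $(c_1,o_1,q_1)\vdash^d_{T,\mathbb X}(c_2,o_2,q_2)$ if there are arrows $e,e'$ with $c_1;e=d;c_2$, $(e\Rightarrow^{o_1}_{o_2}e')\in\Phi(T)$ and $e'_{\mathbb X}(q_1)=q_2$. A $\mathbf{PDA}$-coalgebra $\langle\mathbb X,\alpha\rangle$ *satisfies* $T$ if $(c,o,q)\in\alpha(p)$ and $(c,o,q)\vdash^d_{T,\mathbb X}(c',o',q')$ imply $(c',o',q')\in\alpha(d_{\mathbb X}(p))$. *Saturated coalgebras.* $\mathbf S_T(\mathbb X)$ consists of the countable sets of triples closed under $\vdash^{id}_{T,\mathbb X}$, with operators $d_{\mathbf S_T(\mathbb X)}(A)=\{t_2\mid \exists t_1\in A,\ t_1\vdash^d_{T,\mathbb X}t_2\}$, and it acts on homomorphisms as $\mathbf{PDA}$ does. The inclusions form a natural transformation $\iota:\mathbf S_T\Rightarrow\mathbf{PDA}$, which induces a functor $\mathbf I:\mathbf{Coalg}(\mathbf S_T)\to\mathbf{Coalg}(\mathbf{PDA})$,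 $\langle\mathbb X,\alpha\rangle\mapsto\langle\mathbb X,\alpha;\iota_{\mathbb X}\rangle$. Let $\mathbf{Coalg}(\mathbf{PDA}^I)$ be the full subcategory of $\mathbf{Coalg}(\mathbf{PDA})$ of the coalgebras whose structure map factors through $\iota_{\mathbb X}$ by a homomorphism. *Subcoalgebras and images.* $A$ is a subcoalgebra of $B$ if there is a coalgebra morphism $A\to B$ with all components injective. The homomorphic image of $A$ through a coalgebra morphism $h:A\to B$ is the coalgebra $J$ in a factorization $h=e;m$ into coalgebra morphisms $e:A\to J$, $m:J\to B$ with all components of $e$ surjective and all components of $m$ injective. Sums are small coproducts. *Saturated bisimilarity.* A context interactive system $\mathcal I$ over $\mathbf C$ and $O$ is a $\Gamma(\mathbf C)$-algebra $\mathbb X$ with a relation $tr\subseteq\int X\times O\times\int X$; it has countable degree if each $p\in\int X$ has countably many transitions $(p,o,q)\in tr$. A saturated bisimulation is a family of symmetric relations $R_i\subseteq X_i\times X_i$ such that $p\,R_i\,q$ implies $c_{\mathbb X}(p)\,R_j\,c_{\mathbb X}(q)$ for every $c:i\to j$ and, whenever $(p,o,p')\in tr$ with $p'\in X_k$, there is $q'\in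 X_k$ with $(q,o,q')\in tr$ and $p'\,R_k\,q'$. Write $p\sim^S_i q$ if $p\,R_i\,q$ for some saturated bisimulation $R$. If $\mathcal I$ has countable degree, $\langle\mathbb X,\alpha_{\mathcal I}\rangle$ is the $\mathbf{PDA}$-coalgebra with $\alpha_{\mathcal I}(p)=\{(c,o,q)\mid(c_{\mathbb X}(p),o,q)\in tr\}$. **Theorem.** Let $T$ be an inference system. 1. A $\mathbf{PDA}$-coalgebra is in $\mathbf{Coalg}(\mathbf{PDA}^I)$ if and only if it satisfies $T$. Homomorphic images and sums exist in $\mathbf{Coalg}(\mathbf{PDA})$, and the $\mathbf{PDA}$-coalgebras that satisfy $T$ form a covariety: they are closed under subcoalgebras, homomorphic images and sums. 2. $\mathbf I$ is an isomorphism of categories $\mathbf{Coalg}(\mathbf S_T)\cong\mathbf{Coalg}(\mathbf{PDA}^I)$, and the categories $\mathbf{Coalg}(\mathbf{PDA})$, $\mathbf{Coalg}(\mathbf{PDA}^I)$ and $\mathbf{Coalg}(\mathbf S_T)$ have final objects. 3. For every coalgebra in $\mathbf{Coalg}(\mathbf{PDA}^I)$, the final morphism in $\mathbf{Coalg}(\mathbf{PDA}^I)$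 has the same kernel as the final morphism in $\mathbf{Coalg}(\mathbf{PDA})$. For every $\mathbf S_T$-coalgebra $A$, the final morphism of $A$ in $\mathbf{Coalg}(\mathbf S_T)$ has the same kernel as the final morphism of $\mathbf I(A)$ in $\mathbf{Coalg}(\mathbf{PDA})$. 4. Let $\mathcal I$ be a context interactive system of countable degree over $\mathbf C$ and $O$, with algebra $\mathbb X$. The kernel of the final $\mathbf{PDA}$-morphism from $\langle\mathbb X,\alpha_{\mathcal I}\rangle$ is $\sim^S$. If $\langle\mathbb X,\alpha_{\mathcal I}\rangle$ satisfies $T$, then $\alpha_{\mathcal I}=\alpha'_{\mathcal I};\iota_{\mathbb X}$ for a unique homomorphism $\alpha'_{\mathcal I}:\mathbb X\to\mathbf S_T(\mathbb X)$, and the kernel of the final $\mathbf S_T$-morphism from $\langle\mathbb X,\alpha'_{\mathcal I}\rangle$ is $\sim^S$. -/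

import Mathlib

open CategoryTheory Limits

universe u

namespace SatCoalg

variable {C : Type u} [SmallCategory C] {O : Type u}

/-- The set `∫ X` of elements of a sorted family `X`. -/
abbrev Elements (X : C → Type u) : Type u := Σ k : C, X k

/-- A triple `(c, o, q)` with `c` an arrow of source `i`, `o` an observation and `q ∈ ∫ X`. -/
@[ext]
structure Transition (O : Type u) (X : C → Type u) (i : C) : Type u where
  cod : C
  ctx : i ⟶ cod
  obs : O
  tgt : Elements X

/-- The action of a sorted family of functions on triples. -/
def Transition.map {X Y : C → Type u} (f : ∀ k, X k → Y k) {i : C} (t : Transition O X i) :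
    Transition O Y i :=
  ⟨t.cod, t.ctx, t.obs, ⟨t.tgt.1, f t.tgt.1 t.tgt.2⟩⟩

/-- Precomposition of the context of a triple with an arrow `d`. -/
def Transition.pre {X : C → Type u} {i k : C} (d : i ⟶ k) (t : Transition O X k) : Transition O X i :=
  ⟨t.cod, d ≫ t.ctx, t.obs, t.tgt⟩

/-- The carrier of sort `i`: the countable sets of triples `(c, o, q)` with `c` of source `i`. -/
def PD (O : Type u) (X : C → Type u) (i : C) : Type u :=
  {A : Set (Transition O X i) // A.Countable}

theorem Transition.id_pre {X : C → Type u} {i : C} (t : Transition O X i) : t.pre (𝟙 i) = t := by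
  simp [Transition.pre]

theorem Transition.comp_pre {X : C → Type u} {i j k : C} (d : i ⟶ j) (e : j ⟶ k) (t : Transition O X k) :
    t.pre (d ≫ e) = (t.pre e).pre d := by
  simp [Transition.pre]

/-- Only countably many triples become a given triple by precomposition with `d`. -/
theorem countable_preimage_pre [CountableCategory C] {X : C → Type u} {i k : C} (d : i ⟶ k)
    {A : Set (Transition O X i)} (hA : A.Countable) : {t : Transition O X k | t.pre d ∈ A}.Countable := by
  have h : ({t : Transition O X k | t.pre d ∈ A}) ⊆ ⋃ (j : C) (c : k ⟶ j),
      (fun s : Transition O X i => (⟨j, c, s.obs, s.tgt⟩ : Transition O X k)) '' A := by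
    intro t ht
    simp only [Set.mem_iUnion]
    exact ⟨t.cod, t.ctx, t.pre d, ht, rfl⟩
  exact (Set.countable_iUnion fun j => Set.countable_iUnion fun c => hA.image _).mono h

/-- The `Γ(C)`-algebra `PDA(X)`. The operator `d` sends `A` to
`{(c₂, o, x) | (c₁, o, x) ∈ A and c₁ = d ; c₂}`. -/
def pdaAlg (O : Type u) [CountableCategory C] (X : C ⥤ Type u) : C ⥤ Type u where
  obj i := PD O X.obj i
  map d := ↾(fun A => ⟨{t | t.pre d ∈ A.1}, countable_preimage_pre d A.2⟩)
  map_id i := by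
    ext A
    apply Subtype.ext
    ext t
    change t.pre (𝟙 i) ∈ A.1 ↔ t ∈ A.1
    rw [Transition.id_pre]
  map_comp d e := by
    ext A
    apply Subtype.ext
    ext t
    change t.pre (d ≫ e) ∈ A.1 ↔ (t.pre e).pre d ∈ A.1
    rw [Transition.comp_pre]

/-- The image of a countable set of triples under a sorted family of functions. -/
def PD.map {X Y : C → Type u} (f : ∀ k, X k → Y k) {i : C} (A : PD O X i) : PD O Y i :=
  ⟨Transition.map f '' A.1, A.2.image _⟩

/-- The endofunctor `PDA` on `Γ(C)`-algebras, that is, on functors from `C` to sets. -/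
def PDA (C : Type u) [SmallCategory C] [CountableCategory C] (O : Type u) :
    (C ⥤ Type u) ⥤ (C ⥤ Type u) where
  obj X := pdaAlg O X
  map {X Y} h :=
    { app := fun i => ↾(fun A : PD O X.obj i => (PD.map (fun k => h.app k) A : PD O Y.obj i))
      naturality := by
        intro i k d
        ext A
        apply Subtype.ext
        ext t
        constructor
        · rintro ⟨s, hs, rfl⟩
          exact ⟨s.pre d, hs, rfl⟩
        · rintro ⟨s, hs, hst⟩
          obtain ⟨j, c, o, q⟩ := s
          obtain ⟨j', c', o', q'⟩ := t
          simp only [Transition.map, Transition.pre, Transition.mk.injEq] at hst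
          obtain ⟨rfl, hc, rfl, rfl⟩ := hst
          obtain rfl := eq_of_heq hc
          exact ⟨⟨j, c', o, q⟩, hs, rfl⟩ }
  map_id X := by
    ext i A
    apply Subtype.ext
    exact Set.image_id A.1
  map_comp f g := by
    ext i A
    apply Subtype.ext
    exact Set.image_comp (Transition.map fun k => g.app k) (Transition.map fun k => f.app k) A.1

/-- A rule with premise `p_i --o--> q_j` and conclusion `c(p_i) --o'--> d(q_j)`. -/
structure Rule (C : Type u) [SmallCategory C] (O : Type u) : Type u where
  {i i' j j' : C}
  c : i ⟶ i'
  o : O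
  o' : O
  d : j ⟶ j'

/-- The closure `Φ(T)`: the rules derivable from `T` and the identity rules by composition. -/
inductive Closure (T : Set (Rule C O)) :
    ∀ {i i' j j' : C}, (i ⟶ i') → O → O → (j ⟶ j') → Prop
  | base {i i' j j' : C} (c : i ⟶ i') (o o' : O) (d : j ⟶ j') :
      (⟨c, o, o', d⟩ : Rule C O) ∈ T → Closure T c o o' d
  | id (i j : C) (o : O) : Closure T (𝟙 i) o o (𝟙 j)
  | comp {i i' i'' j j' j'' : C} {c : i ⟶ i'} {d : i' ⟶ i''} {c' : j ⟶ j'} {d' : j' ⟶ j''}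
      {o o' o'' : O} : Closure T c o o' c' → Closure T d o' o'' d' →
      Closure T (c ≫ d) o o'' (c' ≫ d')

/-- Extended derivation `t₁ ⊢^d t₂` in the algebra `X` through `T`. -/
def Deriv (T : Set (Rule C O)) (X : C ⥤ Type u) {i k : C} (d : i ⟶ k)
    (t₁ : Transition O X.obj i) (t₂ : Transition O X.obj k) : Prop :=
  ∃ (e : t₁.cod ⟶ t₂.cod) (e' : t₁.tgt.1 ⟶ t₂.tgt.1),
    t₁.ctx ≫ e = d ≫ t₂.ctx ∧ Closure T e t₁.obs t₂.obs e' ∧ X.map e' t₁.tgt.2 = t₂.tgt.2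

/-- A set of triples is saturated if it is closed under derivation through the identity. -/
def IsSaturated (T : Set (Rule C O)) (X : C ⥤ Type u) {i : C} (A : Set (Transition O X.obj i)) : Prop :=
  ∀ t₁ ∈ A, ∀ t₂, Deriv T X (𝟙 i) t₁ t₂ → t₂ ∈ A

/-- The countable saturated sets of triples. -/
def PS (T : Set (Rule C O)) (X : C ⥤ Type u) (i : C) : Type u :=
  {A : PD O X.obj i // IsSaturated T X A.1}

theorem Deriv.refl_pre (T : Set (Rule C O)) (X : C ⥤ Type u) {i k : C} (d : i ⟶ k)
    (t : Transition O X.obj k) : Deriv T X d (t.pre d) t :=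
  ⟨𝟙 t.cod, 𝟙 t.tgt.1, by simp [Transition.pre], Closure.id _ _ _,
    Functor.map_id_apply X _ t.tgt.2⟩

theorem Deriv.trans {T : Set (Rule C O)} {X : C ⥤ Type u} {i j k : C} {d : i ⟶ j} {e : j ⟶ k}
    {t₁ : Transition O X.obj i} {t₂ : Transition O X.obj j} {t₃ : Transition O X.obj k}
    (h₁ : Deriv T X d t₁ t₂) (h₂ : Deriv T X e t₂ t₃) : Deriv T X (d ≫ e) t₁ t₃ := by
  obtain ⟨a, a', ha, hT, hx⟩ := h₁
  obtain ⟨b, b', hb, hT', hx'⟩ := h₂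
  refine ⟨a ≫ b, a' ≫ b', ?_, hT.comp hT', ?_⟩
  · rw [← Category.assoc, ha, Category.assoc, hb, Category.assoc]
  · simp [hx, hx']

theorem deriv_pre_iff {T : Set (Rule C O)} {X : C ⥤ Type u} {i k : C} {d : i ⟶ k}
    {t₁ : Transition O X.obj i} {t₂ : Transition O X.obj k} :
    Deriv T X (𝟙 i) t₁ (t₂.pre d) ↔ Deriv T X d t₁ t₂ := by
  have h : 𝟙 i ≫ (t₂.pre d).ctx = d ≫ t₂.ctx := Category.id_comp _
  unfold Deriv
  rw [h]
  exact Iff.rfl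

/-- The set of triples derived through `d` from the triples in `A`. -/
def derivedSet (T : Set (Rule C O)) (X : C ⥤ Type u) {i k : C} (d : i ⟶ k)
    (A : Set (Transition O X.obj i)) : Set (Transition O X.obj k) :=
  {t₂ | ∃ t₁ ∈ A, Deriv T X d t₁ t₂}

theorem derivedSet_eq {T : Set (Rule C O)} {X : C ⥤ Type u} {i k : C} (d : i ⟶ k)
    {A : Set (Transition O X.obj i)} (hA : IsSaturated T X A) :
    derivedSet T X d A = {t | t.pre d ∈ A} := by
  ext t
  constructor
  · rintro ⟨s, hs, h⟩
    exact hA s hs _ (deriv_pre_iff.2 h)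
  · intro h
    exact ⟨t.pre d, h, Deriv.refl_pre T X d t⟩

theorem isSaturated_derivedSet {T : Set (Rule C O)} {X : C ⥤ Type u} {i k : C} (d : i ⟶ k)
    (A : Set (Transition O X.obj i)) : IsSaturated T X (derivedSet T X d A) := by
  rintro t₁ ⟨s, hs, h⟩ t₂ h'
  exact ⟨s, hs, by simpa using h.trans h'⟩

theorem IsSaturated.image {T : Set (Rule C O)} {X Y : C ⥤ Type u} (h : X ⟶ Y) {i : C}
    {A : Set (Transition O X.obj i)} (hA : IsSaturated T X A) :
    IsSaturated T Y (Transition.map (fun k => h.app k) '' A) := by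
  rintro _ ⟨⟨j, c, o, ⟨l, x⟩⟩, hs, rfl⟩ ⟨j', c', o', ⟨l', y⟩⟩ ⟨e, e', he, hT, hx⟩
  refine ⟨⟨j', c', o', ⟨l', X.map e' x⟩⟩, hA _ hs _ ⟨e, e', he, hT, rfl⟩, ?_⟩
  have hy : h.app l' (X.map e' x) = y := by
    exact (NatTrans.naturality_apply h e' x).trans hx
  change Transition.mk j' c' o' ⟨l', h.app l' (X.map e' x)⟩ = _
  rw [hy]

/-- The `Γ(C)`-algebra `S_T(X)` of saturated sets. The operator `d` sends `A` to the set of all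
triples derived from `A` through `d`. -/
def satAlg [CountableCategory C] (T : Set (Rule C O)) (X : C ⥤ Type u) : C ⥤ Type u where
  obj i := PS T X i
  map d := ↾(fun A => ⟨⟨derivedSet T X d A.1.1, by
    rw [derivedSet_eq d A.2]; exact countable_preimage_pre d A.1.2⟩, isSaturated_derivedSet d _⟩)
  map_id i := by
    ext A
    apply Subtype.ext
    apply Subtype.ext
    change derivedSet T X (𝟙 i) A.1.1 = A.1.1
    rw [derivedSet_eq _ A.2]
    simp [Transition.id_pre]
  map_comp {i j k} d e := by
    ext A
    apply Subtype.ext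
    apply Subtype.ext
    change derivedSet T X (d ≫ e) A.1.1 = derivedSet T X e (derivedSet T X d A.1.1)
    rw [derivedSet_eq _ (isSaturated_derivedSet d _), derivedSet_eq _ A.2, derivedSet_eq _ A.2]
    simp [Transition.comp_pre]

/-- The endofunctor `S_T`; on arrows it is defined as `PDA`. -/
def ST [CountableCategory C] (T : Set (Rule C O)) : (C ⥤ Type u) ⥤ (C ⥤ Type u) where
  obj X := satAlg T X
  map {X Y} h :=
    { app := fun i => ↾(fun A : PS T X i =>
        (⟨PD.map (fun k => h.app k) A.1, A.2.image h⟩ : PS T Y i))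
      naturality := by
        intro i k d
        ext A
        apply Subtype.ext
        have := congrArg (fun f => f A.1) (((PDA C O).map h).naturality d)
        apply Subtype.ext
        change Transition.map _ '' derivedSet T X d A.1.1 = derivedSet T Y d (Transition.map _ '' A.1.1)
        rw [derivedSet_eq _ A.2, derivedSet_eq _ (A.2.image h)]
        exact congrArg Subtype.val this }
  map_id X := by
    ext i A
    apply Subtype.ext
    apply Subtype.ext
    exact Set.image_id A.1.1
  map_comp f g := by
    ext i A
    apply Subtype.ext
    apply Subtype.ext
    exact Set.image_comp (Transition.map fun k => g.app k) (Transition.map fun k => f.app k) A.1.1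

/-- The natural transformation `ι : S_T ⟶ PDA` whose components are the inclusions. -/
def incl [CountableCategory C] (T : Set (Rule C O)) : ST T ⟶ PDA C O where
  app X :=
    { app := fun i => ↾(fun A : PS T X i => (A.1 : PD O X.obj i))
      naturality := by
        intro i k d
        ext A
        apply Subtype.ext
        exact derivedSet_eq d A.2 }
  naturality _ _ _ := rfl

/-- The category of coalgebras of `PDA`. -/
abbrev CoalgPDA (C : Type u) [SmallCategory C] [CountableCategory C] (O : Type u) :=
  Endofunctor.Coalgebra (PDA C O)

/-- The category of coalgebras of `S_T`. -/
abbrev CoalgST [CountableCategory C] (T : Set (Rule C O)) :=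
  Endofunctor.Coalgebra (ST T)

/-- The set `α(p)` of outgoing transitions of a state `p` of a `PDA`-coalgebra. -/
def outgoing [CountableCategory C] (A : CoalgPDA C O) {i : C} (p : A.V.obj i) :
    Set (Transition O A.V.obj i) :=
  (show PD O A.V.obj i from A.str.app i p).1

/-- A `PDA`-coalgebra satisfies `T`. -/
def Satisfies [CountableCategory C] (T : Set (Rule C O)) : ObjectProperty (CoalgPDA C O) :=
  fun A => ∀ ⦃i k : C⦄ (d : i ⟶ k) (p : A.V.obj i) (t : Transition O A.V.obj i)
    (t' : Transition O A.V.obj k), t ∈ outgoing A p → Deriv T A.V d t t' → t' ∈ outgoing A (A.V.map d p)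

/-- A `PDA`-coalgebra factors through `ι`. -/
def Factors [CountableCategory C] (T : Set (Rule C O)) : ObjectProperty (CoalgPDA C O) :=
  fun A => ∃ α' : A.V ⟶ (ST T).obj A.V, α' ≫ (incl T).app A.V = A.str

/-- The category `Coalg(PDA^I)`: the full subcategory of the coalgebras that factor through `ι`. -/
abbrev CoalgPDAI [CountableCategory C] (T : Set (Rule C O)) := (Factors T).FullSubcategory

/-- The functor `I : Coalg(S_T) ⥤ Coalg(PDA)` induced by `ι`. -/
abbrev inclCoalg [CountableCategory C] (T : Set (Rule C O)) : CoalgST T ⥤ CoalgPDA C O :=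
  Endofunctor.Coalgebra.functorOfNatTrans (incl T)

/-- The functor `I` with its codomain restricted to `Coalg(PDA^I)`. -/
abbrev toCoalgPDAI [CountableCategory C] (T : Set (Rule C O)) : CoalgST T ⥤ CoalgPDAI T :=
  (Factors T).lift (inclCoalg T) fun A => ⟨A.str, rfl⟩

/-- All components of a homomorphism of algebras are epi. -/
def EpiComponents {X Y : C ⥤ Type u} (h : X ⟶ Y) : Prop := ∀ i : C, Epi (h.app i)

/-- All components of a homomorphism of algebras are mono. -/
def MonoComponents {X Y : C ⥤ Type u} (h : X ⟶ Y) : Prop := ∀ i : C, Mono (h.app i)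

/-- `A` is a subcoalgebra of `B`. -/
def IsSubcoalgebra [CountableCategory C] (A B : CoalgPDA C O) : Prop :=
  ∃ m : A ⟶ B, MonoComponents m.f

/-- `J` is a homomorphic image of `A` through `h`. -/
def IsHomomorphicImage [CountableCategory C] {A B : CoalgPDA C O} (h : A ⟶ B)
    (J : CoalgPDA C O) : Prop :=
  ∃ (e : A ⟶ J) (m : J ⟶ B), EpiComponents e.f ∧ MonoComponents m.f ∧ e ≫ m = h

/-- A class of `PDA`-coalgebras is a covariety: it is closed under subcoalgebras, homomorphic
images and (small) sums. -/
structure IsCovariety [CountableCategory C] (P : ObjectProperty (CoalgPDA C O)) : Prop where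
  sub : ∀ A B : CoalgPDA C O, IsSubcoalgebra A B → P B → P A
  image : ∀ (A B : CoalgPDA C O) (h : A ⟶ B) (J : CoalgPDA C O),
    IsHomomorphicImage h J → P A → P J
  sum : ∀ (K : Type u) (A : K → CoalgPDA C O) (c : Cofan A), IsColimit c →
    (∀ k, P (A k)) → P c.pt

/-- A context interactive system over the category `C` with observations in `O`. -/
structure CIS (C : Type u) [SmallCategory C] (O : Type u) where
  alg : C ⥤ Type u
  tr : Set (Elements alg.obj × O × Elements alg.obj)

/-- Every state has countably many outgoing transitions. -/
def CIS.CountableDegree (I : CIS C O) : Prop :=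
  ∀ p : Elements I.alg.obj, {t : O × Elements I.alg.obj | (p, t.1, t.2) ∈ I.tr}.Countable

/-- Saturated bisimulations. -/
def CIS.IsSatBisimulation (I : CIS C O) (R : ∀ i : C, I.alg.obj i → I.alg.obj i → Prop) : Prop :=
  (∀ i p q, R i p q → R i q p) ∧
  (∀ (i j : C) (c : i ⟶ j) (p q), R i p q → R j (I.alg.map c p) (I.alg.map c q)) ∧
  (∀ i p q, R i p q → ∀ (o : O) (k : C) (p' : I.alg.obj k), (⟨i, p⟩, o, ⟨k, p'⟩) ∈ I.tr →
    ∃ q' : I.alg.obj k, (⟨i, q⟩, o, ⟨k, q'⟩) ∈ I.tr ∧ R k p' q')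

/-- Saturated bisimilarity `∼^S`. -/
def CIS.SatBisim (I : CIS C O) {i : C} (p q : I.alg.obj i) : Prop :=
  ∃ R : ∀ i : C, I.alg.obj i → I.alg.obj i → Prop, I.IsSatBisimulation R ∧ R i p q

/-- The saturated transitions of a state `p`: `(c, o, q)` with `c(p) --o--> q`. -/
def CIS.satTrans (I : CIS C O) {i : C} (p : I.alg.obj i) : Set (Transition O I.alg.obj i) :=
  {t | ((⟨t.cod, I.alg.map t.ctx p⟩ : Elements I.alg.obj), t.obs, t.tgt) ∈ I.tr}

theorem CIS.countable_satTrans [CountableCategory C] (I : CIS C O) (hI : I.CountableDegree)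
    {i : C} (p : I.alg.obj i) : (I.satTrans p).Countable := by
  have h : I.satTrans p ⊆ ⋃ (j : C) (c : i ⟶ j),
      (fun s : O × Elements I.alg.obj => (⟨j, c, s.1, s.2⟩ : Transition O I.alg.obj i)) ''
        {s | ((⟨j, I.alg.map c p⟩ : Elements I.alg.obj), s.1, s.2) ∈ I.tr} := by
    intro t ht
    simp only [Set.mem_iUnion]
    exact ⟨t.cod, t.ctx, (t.obs, t.tgt), ht, rfl⟩
  exact (Set.countable_iUnion fun j => Set.countable_iUnion fun c => (hI _).image _).mono h

/-- The `PDA`-coalgebra of the saturated transition system of `I`. -/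
def CIS.satCoalg [CountableCategory C] (I : CIS C O) (hI : I.CountableDegree) :
    CoalgPDA C O where
  V := I.alg
  str :=
    { app := fun i => ↾(fun p => (⟨I.satTrans p, I.countable_satTrans hI p⟩ : PD O I.alg.obj i))
      naturality := by
        intro i k d
        ext p
        apply Subtype.ext
        ext t
        change ((⟨t.cod, I.alg.map t.ctx (I.alg.map d p)⟩ : Elements I.alg.obj), t.obs, t.tgt) ∈ I.tr
          ↔ ((⟨t.cod, I.alg.map (d ≫ t.ctx) p⟩ : Elements I.alg.obj), t.obs, t.tgt) ∈ I.tr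
        simp }

end SatCoalg

/-! Everything is reduced to one relation, bisimilarity of states of `PDA`-coalgebras, which does
not mention `T`. Graphs of morphisms are bisimulations, so states identified by a morphism are
bisimilar. Conversely, bisimilarity is compatible with operators and transitions, so every coalgebra
has a quotient by it (`quotientCoalg`). In this quotient bisimilar states are equal, hence parallel
morphisms into it agree.

Final objects exist in every covariety. Arrows and transitions are countable, so each state
generates a countable subcoalgebra, and up to isomorphism these form a small set. The sum of those
in the covariety, divided by bisimilarity, stays in the covariety and is final. In a class closed
under homomorphic images the final morphism factors through the quotient, so its kernel is
bisimilarity (`from_eq_iff_bisimilar`); this is why the kernels do not depend on `T`.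

By naturality of the structure map, deriving through `d` at `p` amounts to deriving through the
identity and then stripping `d`. Hence satisfying `T` means that all transition sets are saturated,
which is factorization through `ι` (`factors_iff_satisfies`). Derivations pass along morphisms,
which gives the covariety. Since `ι` is mono, factorizations are unique and `I` is an isomorphism.
For a context interactive system, the transitions of `p` with context `c` are those of `c(p)`, so
bisimilarity is saturated bisimilarity. -/

namespace CategoryTheory.Endofunctor.Coalgebra

/-! ### Colimits of coalgebras -/

variable {D : Type*} [Category* D] {F : D ⥤ D} {J : Type*} [Category* J]

/-- The legs of a cocone over the carriers of a diagram of coalgebras. -/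
def leg {K : J ⥤ Coalgebra F} (c : Cocone (K ⋙ forget F)) (j : J) : (K.obj j).V ⟶ c.pt :=
  c.ι.app j

theorem map_leg {K : J ⥤ Coalgebra F} (c : Cocone (K ⋙ forget F)) {i j : J} (f : i ⟶ j) :
    (K.map f).f ≫ leg c j = leg c i :=
  c.w f

/-- The cocone that induces the structure map on a colimit of carriers. -/
def strCocone {K : J ⥤ Coalgebra F} (c : Cocone (K ⋙ forget F)) : Cocone (K ⋙ forget F) where
  pt := F.obj c.pt
  ι :=
    { app := fun j => (K.obj j).str ≫ F.map (leg c j)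
      naturality := fun i j f => by
        change (K.map f).f ≫ (K.obj j).str ≫ F.map (leg c j) =
          ((K.obj i).str ≫ F.map (leg c i)) ≫ 𝟙 _
        rw [Category.comp_id, ← map_leg c f, F.map_comp, ← (K.map f).h_assoc] }

/-- The structure map on a colimit of carriers. -/
def colimitStr {K : J ⥤ Coalgebra F} {c : Cocone (K ⋙ forget F)} (hc : IsColimit c) :
    c.pt ⟶ F.obj c.pt :=
  hc.desc (strCocone c)

theorem leg_colimitStr {K : J ⥤ Coalgebra F} {c : Cocone (K ⋙ forget F)} (hc : IsColimit c)
    (j : J) : leg c j ≫ colimitStr hc = (K.obj j).str ≫ F.map (leg c j) :=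
  hc.fac (strCocone c) j

/-- The lift of a colimit cocone of carriers to a cocone of coalgebras. -/
def liftedCocone (K : J ⥤ Coalgebra F) {c : Cocone (K ⋙ forget F)} (hc : IsColimit c) :
    Cocone K where
  pt := { V := c.pt, str := colimitStr hc }
  ι :=
    { app := fun j => { f := leg c j, h := (leg_colimitStr hc j).symm }
      naturality := fun i j f => by
        ext1
        exact c.ι.naturality f }

/-- The underlying morphism of the comparison from the lifted cocone. -/
def descCarrier {K : J ⥤ Coalgebra F} {c : Cocone (K ⋙ forget F)} (hc : IsColimit c)
    (s : Cocone K) : c.pt ⟶ s.pt.V :=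
  hc.desc ((forget F).mapCocone s)

theorem leg_descCarrier {K : J ⥤ Coalgebra F} {c : Cocone (K ⋙ forget F)} (hc : IsColimit c)
    (s : Cocone K) (j : J) : leg c j ≫ descCarrier hc s = (s.ι.app j).f :=
  hc.fac ((forget F).mapCocone s) j

theorem colimitStr_descCarrier {K : J ⥤ Coalgebra F} {c : Cocone (K ⋙ forget F)}
    (hc : IsColimit c) (s : Cocone K) :
    colimitStr hc ≫ F.map (descCarrier hc s) = descCarrier hc s ≫ s.pt.str := by
  refine hc.hom_ext fun j => ?_
  have h : (K.obj j).str ≫ F.map (leg c j ≫ descCarrier hc s) =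
      (leg c j ≫ descCarrier hc s) ≫ s.pt.str := by
    rw [leg_descCarrier]
    exact (s.ι.app j).h
  change leg c j ≫ colimitStr hc ≫ F.map (descCarrier hc s) =
    leg c j ≫ descCarrier hc s ≫ s.pt.str
  rw [← Category.assoc, leg_colimitStr, Category.assoc, ← F.map_comp, h, Category.assoc]

/-- The lifted cocone of coalgebras is a colimit cocone. -/
def isColimitLiftedCocone (K : J ⥤ Coalgebra F) {c : Cocone (K ⋙ forget F)} (hc : IsColimit c) :
    IsColimit (liftedCocone K hc) where
  desc s := { f := descCarrier hc s, h := colimitStr_descCarrier hc s }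
  fac s j := by
    ext1
    exact leg_descCarrier hc s j
  uniq s m w := by
    ext1
    exact hc.uniq ((forget F).mapCocone s) m.f fun j => congrArg Hom.f (w j)

/-- The forgetful functor from coalgebras creates colimits. -/
noncomputable instance forgetCreatesColimit (K : J ⥤ Coalgebra F) :
    CreatesColimit K (forget F) :=
  -- A coalgebra morphism with invertible carrier map is invertible, so lifting each colimit cocone
  -- of carriers to a colimit cocone suffices.
  createsColimitOfReflectsIso fun _ hc =>
    { liftedCocone := liftedCocone K hc
      validLift := Cocone.ext (Iso.refl _) fun _ => Category.comp_id _
      makesColimit := isColimitLiftedCocone K hc }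

end CategoryTheory.Endofunctor.Coalgebra

/-! ### Elementwise form of `PDA`-coalgebras and their morphisms -/

namespace SatCoalg

variable {C : Type u} [SmallCategory C] {O : Type u}

/-- Context, observation and target sort are unchanged by `Transition.map`, so only the target
element has to be chosen. -/
theorem mem_image_transitionMap {X Y : C → Type u} {f : ∀ k, X k → Y k} {i : C}
    {S : Set (Transition O X i)} {j k : C} {c : i ⟶ j} {o : O} {y : Y k} :
    (⟨j, c, o, ⟨k, y⟩⟩ : Transition O Y i) ∈ Transition.map f '' S ↔
      ∃ x, (⟨j, c, o, ⟨k, x⟩⟩ : Transition O X i) ∈ S ∧ f k x = y := by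
  constructor
  · rintro ⟨⟨j', c', o', k', x⟩, hs, h⟩
    simp only [Transition.map, Transition.mk.injEq, Sigma.mk.injEq] at h
    obtain ⟨rfl, hc, rfl, rfl, hy⟩ := h
    obtain rfl := eq_of_heq hc
    exact ⟨x, hs, eq_of_heq hy⟩
  · rintro ⟨x, hx, rfl⟩
    exact ⟨_, hx, rfl⟩

theorem transitionMap_injective {X Y : C → Type u} {f : ∀ k, X k → Y k}
    (hf : ∀ k, Function.Injective (f k)) {i : C} :
    Function.Injective (Transition.map (O := O) f (i := i)) := by
  rintro ⟨j, c, o, k, x⟩ ⟨j', c', o', k', x'⟩ h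
  simp only [Transition.map, Transition.mk.injEq, Sigma.mk.injEq] at h
  obtain ⟨rfl, hc, rfl, rfl, hx⟩ := h
  obtain rfl := eq_of_heq hc
  obtain rfl := hf _ (eq_of_heq hx)
  rfl

variable [CountableCategory C]

theorem outgoing_countable (A : CoalgPDA C O) {i : C} (p : A.V.obj i) :
    (outgoing A p).Countable :=
  (show PD O A.V.obj i from A.str.app i p).2

/-- This is naturality of the structure map: the transitions of `p` determine those of all `d(p)`.
-/
theorem mem_outgoing_map (A : CoalgPDA C O) {i k : C} (d : i ⟶ k) (p : A.V.obj i)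
    (t : Transition O A.V.obj k) : t ∈ outgoing A (A.V.map d p) ↔ t.pre d ∈ outgoing A p := by
  have h := NatTrans.naturality_apply A.str d p
  have h' : outgoing A (A.V.map d p) = {t | t.pre d ∈ outgoing A p} :=
    congrArg Subtype.val h
  rw [h']
  rfl

/-- Construct a `PDA`-coalgebra from its sets of outgoing transitions. -/
def coalgMk (X : C ⥤ Type u) (α : ∀ i, X.obj i → Set (Transition O X.obj i))
    (hc : ∀ i p, (α i p).Countable)
    (hn : ∀ (i k : C) (d : i ⟶ k) (p : X.obj i) (t : Transition O X.obj k),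
      t ∈ α k (X.map d p) ↔ t.pre d ∈ α i p) : CoalgPDA C O where
  V := X
  str :=
    { app := fun i => ↾(fun p => (⟨α i p, hc i p⟩ : PD O X.obj i))
      naturality := by
        intro i k d
        ext p
        apply Subtype.ext
        ext t
        exact hn i k d p t }

/-- The two inclusions of this equality are the forth and back conditions for the graph of `f`. -/
theorem outgoing_app {A B : CoalgPDA C O} (f : A ⟶ B) {i : C} (p : A.V.obj i) :
    outgoing B (f.f.app i p) = Transition.map (fun k => f.f.app k) '' outgoing A p :=
  (congrArg Subtype.val (congrArg (fun g => g.app i p) f.h)).symm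

/-- Construct a morphism of `PDA`-coalgebras from its action on outgoing transitions. -/
def coalgHomMk {A B : CoalgPDA C O} (f : A.V ⟶ B.V)
    (h : ∀ (i : C) (p : A.V.obj i),
      outgoing B (f.app i p) = Transition.map (fun k => f.app k) '' outgoing A p) : A ⟶ B where
  f := f
  h := by
    ext i p
    exact Subtype.ext (h i p).symm

/-! ### Bisimilarity of states of `PDA`-coalgebras -/

/-- Bisimulations between `PDA`-coalgebras. -/
structure IsBisimulation (A B : CoalgPDA C O) (R : ∀ i : C, A.V.obj i → B.V.obj i → Prop) :
    Prop where
  map : ∀ {i j : C} (d : i ⟶ j) {p q}, R i p q → R j (A.V.map d p) (B.V.map d q)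
  forth : ∀ {i : C} {p q}, R i p q → ∀ {j : C} {c : i ⟶ j} {o : O} {k : C} {p' : A.V.obj k},
    (⟨j, c, o, ⟨k, p'⟩⟩ : Transition O A.V.obj i) ∈ outgoing A p →
      ∃ q', (⟨j, c, o, ⟨k, q'⟩⟩ : Transition O B.V.obj i) ∈ outgoing B q ∧ R k p' q'
  back : ∀ {i : C} {p q}, R i p q → ∀ {j : C} {c : i ⟶ j} {o : O} {k : C} {q' : B.V.obj k},
    (⟨j, c, o, ⟨k, q'⟩⟩ : Transition O B.V.obj i) ∈ outgoing B q →
      ∃ p', (⟨j, c, o, ⟨k, p'⟩⟩ : Transition O A.V.obj i) ∈ outgoing A p ∧ R k p' q'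

/-- Two states are bisimilar if some bisimulation relates them. -/
def Bisimilar (A B : CoalgPDA C O) (i : C) (p : A.V.obj i) (q : B.V.obj i) : Prop :=
  ∃ R, IsBisimulation A B R ∧ R i p q

theorem isBisimulation_bisimilar (A B : CoalgPDA C O) : IsBisimulation A B (Bisimilar A B) where
  map := fun d _ _ ⟨R, hR, h⟩ => ⟨R, hR, hR.map d h⟩
  forth := fun ⟨R, hR, h⟩ _ _ _ _ _ ht =>
    let ⟨q', hq, hr⟩ := hR.forth h ht
    ⟨q', hq, R, hR, hr⟩
  back := fun ⟨R, hR, h⟩ _ _ _ _ _ ht =>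
    let ⟨q', hq, hr⟩ := hR.back h ht
    ⟨q', hq, R, hR, hr⟩

theorem Bisimilar.symm {A B : CoalgPDA C O} {i : C} {p : A.V.obj i} {q : B.V.obj i} :
    Bisimilar A B i p q → Bisimilar B A i q p :=
  fun ⟨R, hR, h⟩ => ⟨fun i q p => R i p q,
    { map := fun d _ _ h => hR.map d h
      forth := fun h _ _ _ _ _ ht => hR.back h ht
      back := fun h _ _ _ _ _ ht => hR.forth h ht }, h⟩

theorem Bisimilar.trans {A B D : CoalgPDA C O} {i : C} {p : A.V.obj i} {q : B.V.obj i}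
    {r : D.V.obj i} (h₁ : Bisimilar A B i p q) (h₂ : Bisimilar B D i q r) :
    Bisimilar A D i p r := by
  refine ⟨fun i p r => ∃ q, Bisimilar A B i p q ∧ Bisimilar B D i q r, ?_, q, h₁, h₂⟩
  have hA := isBisimulation_bisimilar A B
  have hB := isBisimulation_bisimilar B D
  constructor
  · rintro i j d p r ⟨q, h, h'⟩
    exact ⟨_, hA.map d h, hB.map d h'⟩
  · rintro i p r ⟨q, h, h'⟩ j c o k p' ht
    obtain ⟨q', hq, hpq⟩ := hA.forth h ht
    obtain ⟨r', hr, hqr⟩ := hB.forth h' hq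
    exact ⟨r', hr, q', hpq, hqr⟩
  · rintro i p r ⟨q, h, h'⟩ j c o k r' ht
    obtain ⟨q', hq, hqr⟩ := hB.back h' ht
    obtain ⟨p', hp, hpq⟩ := hA.back h hq
    exact ⟨p', hp, q', hpq, hqr⟩

/-- A state is bisimilar to its image under a morphism. -/
theorem bisimilar_app {A B : CoalgPDA C O} (f : A ⟶ B) {i : C} (p : A.V.obj i) :
    Bisimilar A B i p (f.f.app i p) := by
  refine ⟨fun i p q => f.f.app i p = q, ?_, rfl⟩
  constructor
  · rintro i j d p _ rfl
    exact NatTrans.naturality_apply f.f d p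
  · rintro i p _ rfl j c o k p' ht
    refine ⟨_, ?_, rfl⟩
    rw [outgoing_app]
    exact ⟨_, ht, rfl⟩
  · rintro i p _ rfl j c o k q' ht
    rw [outgoing_app] at ht
    exact mem_image_transitionMap.1 ht

theorem Bisimilar.refl (A : CoalgPDA C O) {i : C} (p : A.V.obj i) : Bisimilar A A i p p :=
  bisimilar_app (𝟙 A) p

/-- The graph of `f` is composed with the converse of the graph of `g`. This half of the kernel
description needs no closure property. -/
theorem bisimilar_of_app_eq {A B D : CoalgPDA C O} {f : A ⟶ D} {g : B ⟶ D} {i : C}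
    {p : A.V.obj i} {q : B.V.obj i} (h : f.f.app i p = g.f.app i q) : Bisimilar A B i p q :=
  (h ▸ bisimilar_app f p).trans (bisimilar_app g q).symm

/-- Bisimilarity as a setoid on the states of one sort. -/
def bisimSetoid (A : CoalgPDA C O) (i : C) : Setoid (A.V.obj i) where
  r := Bisimilar A A i
  iseqv := ⟨Bisimilar.refl A, Bisimilar.symm, Bisimilar.trans⟩

/-- The algebra of bisimilarity classes. -/
def quotientAlg (A : CoalgPDA C O) : C ⥤ Type u where
  obj i := Quotient (bisimSetoid A i)
  map d := ↾(Quotient.map (A.V.map d) fun _ _ h => (isBisimulation_bisimilar A A).map d h)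
  map_id i := by
    ext x
    induction x using Quotient.inductionOn with | h p
    exact congrArg (Quotient.mk _) (Functor.map_id_apply A.V i p)
  map_comp d e := by
    ext x
    induction x using Quotient.inductionOn with | h p
    exact congrArg (Quotient.mk _) (Functor.map_comp_apply A.V d e p)

/-- The projection to the algebra of bisimilarity classes. -/
def quotientAlgMap (A : CoalgPDA C O) : A.V ⟶ quotientAlg A where
  app i := ↾(fun p => (Quotient.mk (bisimSetoid A i) p : Quotient (bisimSetoid A i)))

theorem quotientAlgMap_eq_iff {A : CoalgPDA C O} {i : C} {p q : A.V.obj i} :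
    (quotientAlgMap A).app i p = (quotientAlgMap A).app i q ↔ Bisimilar A A i p q :=
  Quotient.eq (r := bisimSetoid A i)

/-- Matching transitions have targets in the same class, so the structure map of the quotient is
well defined. -/
theorem image_outgoing_congr {A : CoalgPDA C O} {i : C} {p q : A.V.obj i}
    (h : Bisimilar A A i p q) :
    Transition.map (fun k => (quotientAlgMap A).app k) '' outgoing A p =
      Transition.map (fun k => (quotientAlgMap A).app k) '' outgoing A q := by
  ext ⟨j, c, o, k, x⟩
  simp only [mem_image_transitionMap]
  constructor
  · rintro ⟨p', hp, rfl⟩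
    obtain ⟨q', hq, hpq⟩ := (isBisimulation_bisimilar A A).forth h hp
    exact ⟨q', hq, quotientAlgMap_eq_iff.2 hpq.symm⟩
  · rintro ⟨q', hq, rfl⟩
    obtain ⟨p', hp, hpq⟩ := (isBisimulation_bisimilar A A).back h hq
    exact ⟨p', hp, quotientAlgMap_eq_iff.2 hpq⟩

/-- The quotient of a `PDA`-coalgebra by bisimilarity. -/
def quotientCoalg (A : CoalgPDA C O) : CoalgPDA C O :=
  coalgMk (quotientAlg A)
    (fun _ => Quotient.lift
      (fun p => Transition.map (fun k => (quotientAlgMap A).app k) '' outgoing A p)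
      fun _ _ h => image_outgoing_congr h)
    (fun _ x => by
      induction x using Quotient.inductionOn with | h p
      exact (outgoing_countable A p).image _)
    (fun i k d x t => by
      induction x using Quotient.inductionOn with | h p
      obtain ⟨j, c, o, l, y⟩ := t
      -- On a representative, the condition is naturality of the structure map of `A`, applied
      -- before passing to classes of targets.
      change _ ∈ Transition.map _ '' outgoing A (A.V.map d p) ↔
        (⟨j, d ≫ c, o, ⟨l, y⟩⟩ : Transition O (quotientAlg A).obj i) ∈
          Transition.map _ '' outgoing A p
      rw [mem_image_transitionMap, mem_image_transitionMap]
      simp only [mem_outgoing_map]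
      rfl)

/-- The projection to the quotient by bisimilarity. -/
def quotientMap (A : CoalgPDA C O) : A ⟶ quotientCoalg A :=
  coalgHomMk (quotientAlgMap A) fun _ _ => rfl

theorem quotientMap_eq_iff {A : CoalgPDA C O} {i : C} {p q : A.V.obj i} :
    (quotientMap A).f.app i p = (quotientMap A).f.app i q ↔ Bisimilar A A i p q :=
  quotientAlgMap_eq_iff

theorem quotientMap_surjective (A : CoalgPDA C O) (i : C) :
    Function.Surjective ((quotientMap A).f.app i) :=
  Quotient.mk_surjective

theorem quotientCoalg_isImage (A : CoalgPDA C O) :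
    IsHomomorphicImage (quotientMap A) (quotientCoalg A) :=
  ⟨quotientMap A, 𝟙 _, fun i => (epi_iff_surjective _).2 (quotientMap_surjective A i),
    fun _ => inferInstanceAs (Mono (𝟙 _)), Category.comp_id _⟩

/-- Bisimilar states of the quotient by bisimilarity are equal. -/
theorem eq_of_bisimilar_quotient {A : CoalgPDA C O} {i : C} {x y : (quotientCoalg A).V.obj i}
    (h : Bisimilar _ _ i x y) : x = y := by
  obtain ⟨p, rfl⟩ := quotientMap_surjective A i x
  obtain ⟨q, rfl⟩ := quotientMap_surjective A i y
  exact quotientMap_eq_iff.2 (((bisimilar_app _ p).trans h).trans (bisimilar_app _ q).symm)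

/-- Parallel morphisms to the quotient by bisimilarity are equal. -/
theorem quotientCoalg_hom_ext {A B : CoalgPDA C O} (f g : B ⟶ quotientCoalg A) : f = g := by
  ext i p
  exact eq_of_bisimilar_quotient ((bisimilar_app f p).symm.trans (bisimilar_app g p))

/-- If every state of `B` is bisimilar to a state of `A`, there is a morphism from `B` to the
quotient of `A` by bisimilarity. -/
theorem exists_hom_quotientCoalg {A B : CoalgPDA C O}
    (h : ∀ (i : C) (b : B.V.obj i), ∃ a, Bisimilar B A i b a) :
    Nonempty (B ⟶ quotientCoalg A) := by
  have h' : ∀ (i : C) (b : B.V.obj i), ∃ x, Bisimilar B (quotientCoalg A) i b x := fun i b =>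
    let ⟨a, ha⟩ := h i b
    ⟨_, ha.trans (bisimilar_app (quotientMap A) a)⟩
  choose f hf using h'
  -- `f i b` is the only state of the quotient bisimilar to `b`; this uniqueness makes the pointwise
  -- choices a coalgebra morphism.
  have hu : ∀ {i : C} {b : B.V.obj i} {x}, Bisimilar B (quotientCoalg A) i b x → f i b = x :=
    fun hx => eq_of_bisimilar_quotient ((hf _ _).symm.trans hx)
  have hbis := isBisimulation_bisimilar B (quotientCoalg A)
  refine ⟨coalgHomMk
    { app := fun i => ↾(f i)
      naturality := fun i j d => by
        ext b
        exact hu (hbis.map d (hf i b)) } fun i b => ?_⟩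
  ext ⟨j, c, o, k, x⟩
  rw [mem_image_transitionMap]
  constructor
  · intro hx
    obtain ⟨b', hb, hr⟩ := hbis.back (hf i b) hx
    exact ⟨b', hb, hu hr⟩
  · rintro ⟨b', hb, rfl⟩
    obtain ⟨x', hx, hr⟩ := hbis.forth (hf i b) hb
    have := hu hr
    subst this
    exact hx

/-! ### Subcoalgebras -/

/-- A sorted subset closed under operators and transitions. -/
structure IsClosedSub (A : CoalgPDA C O) (S : Set (Elements A.V.obj)) : Prop where
  map : ∀ {i j : C} (d : i ⟶ j) (p : A.V.obj i), ⟨i, p⟩ ∈ S → ⟨j, A.V.map d p⟩ ∈ S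
  tgt : ∀ {i : C} (p : A.V.obj i), ⟨i, p⟩ ∈ S → ∀ t ∈ outgoing A p, t.tgt ∈ S

/-- The subalgebra on a closed sorted subset. -/
def restrictAlg {A : CoalgPDA C O} {S : Set (Elements A.V.obj)} (hS : IsClosedSub A S) :
    C ⥤ Type u where
  obj i := {p : A.V.obj i // ⟨i, p⟩ ∈ S}
  map d := ↾(fun p => ⟨A.V.map d p.1, hS.map d p.1 p.2⟩)
  map_id i := by
    ext p
    exact Functor.map_id_apply A.V i p.1
  map_comp d e := by
    ext p
    exact Functor.map_comp_apply A.V d e p.1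

/-- The subcoalgebra on a closed sorted subset. -/
def restrictCoalg {A : CoalgPDA C O} {S : Set (Elements A.V.obj)} (hS : IsClosedSub A S) :
    CoalgPDA C O :=
  coalgMk (restrictAlg hS)
    (fun _ p => Transition.map (fun _ q => q.1) ⁻¹' outgoing A p.1)
    (fun _ p => (outgoing_countable A p.1).preimage
      (transitionMap_injective fun _ => Subtype.val_injective))
    (fun _ _ d p _ => mem_outgoing_map A d p.1 _)

/-- The inclusion of the subcoalgebra on a closed sorted subset. -/
def restrictMap {A : CoalgPDA C O} {S : Set (Elements A.V.obj)} (hS : IsClosedSub A S) :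
    restrictCoalg hS ⟶ A :=
  coalgHomMk { app := fun i => ↾(fun p : {p : A.V.obj i // ⟨i, p⟩ ∈ S} => p.1) } fun i p => by
    ext ⟨j, c, o, k, x⟩
    rw [mem_image_transitionMap]
    constructor
    · intro hx
      -- Closure under targets keeps every transition of `p` inside the subset, so none is lost by
      -- restriction.
      exact ⟨⟨x, hS.tgt p.1 p.2 _ hx⟩, hx, rfl⟩
    · rintro ⟨y, hy, rfl⟩
      exact hy

theorem restrictMap_injective {A : CoalgPDA C O} {S : Set (Elements A.V.obj)}
    (hS : IsClosedSub A S) (i : C) : Function.Injective ((restrictMap hS).f.app i) :=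
  Subtype.val_injective

theorem restrictMap_mono {A : CoalgPDA C O} {S : Set (Elements A.V.obj)}
    (hS : IsClosedSub A S) : MonoComponents (restrictMap hS).f :=
  fun i => (mono_iff_injective _).2 (restrictMap_injective hS i)

/-- A morphism with values in a closed sorted subset factors through its inclusion. -/
def restrictLift {A B : CoalgPDA C O} {S : Set (Elements A.V.obj)} (hS : IsClosedSub A S)
    (f : B ⟶ A) (hf : ∀ i p, ⟨i, f.f.app i p⟩ ∈ S) : B ⟶ restrictCoalg hS :=
  coalgHomMk
    { app := fun i => ↾(fun p => (⟨f.f.app i p, hf i p⟩ : {p : A.V.obj i // ⟨i, p⟩ ∈ S}))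
      naturality := fun i j d => by
        ext p
        apply Subtype.ext
        exact NatTrans.naturality_apply f.f d p } fun i p => by
    ext ⟨j, c, o, k, x⟩
    rw [mem_image_transitionMap]
    change (⟨j, c, o, ⟨k, x.1⟩⟩ : Transition O A.V.obj i) ∈ outgoing A (f.f.app i p) ↔ _
    rw [outgoing_app, mem_image_transitionMap]
    exact exists_congr fun q => and_congr_right fun _ =>
      ⟨fun h => Subtype.ext h, fun h => congrArg Subtype.val h⟩

/-- The image is carried by the sorted range of `h`. It is closed under operators by naturality, and
under targets because each transition of `h(a)` is the image of one of `a`. -/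
theorem exists_isHomomorphicImage {A B : CoalgPDA C O} (h : A ⟶ B) :
    ∃ J, IsHomomorphicImage h J := by
  have hS : IsClosedSub B {x | ∃ a : A.V.obj x.1, h.f.app x.1 a = x.2} := by
    constructor
    · intro i j d p hp
      obtain ⟨a, rfl⟩ : ∃ a : A.V.obj i, h.f.app i a = p := hp
      exact ⟨A.V.map d a, NatTrans.naturality_apply h.f d a⟩
    · rintro i p hp ⟨j, c, o, k, x⟩ ht
      obtain ⟨a, rfl⟩ : ∃ a : A.V.obj i, h.f.app i a = p := hp
      rw [outgoing_app, mem_image_transitionMap] at ht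
      obtain ⟨a', -, h'⟩ := ht
      exact ⟨a', h'⟩
  refine ⟨restrictCoalg hS, restrictLift hS h fun i p => ⟨p, rfl⟩, restrictMap hS, fun i => ?_,
    restrictMap_mono hS, rfl⟩
  rw [epi_iff_surjective]
  rintro ⟨p, a, ha⟩
  exact ⟨a, Subtype.ext ha⟩

/-- Every state lies in a countable subset closed under operators and transitions. -/
theorem exists_countable_closed (A : CoalgPDA C O) (x : Elements A.V.obj) :
    ∃ S : Set (Elements A.V.obj), S.Countable ∧ IsClosedSub A S ∧ x ∈ S := by
  -- One step applies all operators and follows all transitions. Both give countably many results,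
  -- so the union of the finite iterates from `x` is countable and closed.
  let step : Elements A.V.obj → Set (Elements A.V.obj) := fun y =>
    (⋃ j : C, Set.range fun d : y.1 ⟶ j => (⟨j, A.V.map d y.2⟩ : Elements A.V.obj)) ∪
      Transition.tgt '' outgoing A y.2
  have hstep : ∀ y, (step y).Countable := fun y =>
    (Set.countable_iUnion fun _ => Set.countable_range _).union
      ((outgoing_countable A y.2).image _)
  let S : ℕ → Set (Elements A.V.obj) := fun n =>
    Nat.rec {x} (fun _ s => ⋃ y ∈ s, step y) n
  have hS : ∀ n, (S n).Countable := by
    intro n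
    induction n with
    | zero => exact Set.countable_singleton x
    | succ n ih => exact ih.biUnion fun y _ => hstep y
  have hmem : ∀ {y z}, y ∈ ⋃ n, S n → z ∈ step y → z ∈ ⋃ n, S n := by
    intro y z hy hz
    obtain ⟨n, hn⟩ := Set.mem_iUnion.1 hy
    exact Set.mem_iUnion.2 ⟨n + 1, Set.mem_biUnion hn hz⟩
  refine ⟨⋃ n, S n, Set.countable_iUnion hS, ⟨?_, ?_⟩, Set.mem_iUnion.2 ⟨0, rfl⟩⟩
  · intro i j d p hp
    exact hmem hp (Or.inl (Set.mem_iUnion.2 ⟨j, d, rfl⟩))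
  · intro i p hp t ht
    exact hmem hp (Or.inr ⟨t, ht, rfl⟩)

/-! ### Final coalgebras -/

/-- The small category of sets of natural numbers. -/
abbrev NatSets : Type u := InducedCategory (Type u) fun s : Set (ULift.{u} ℕ) => (s : Type u)

/-- The inclusion of the sets of natural numbers into all sets. -/
abbrev natSetsFunctor : NatSets.{u} ⥤ Type u := inducedFunctor _

/-- The coalgebras whose carriers are sets of natural numbers. -/
def SmallCoalg (C : Type u) [SmallCategory C] [CountableCategory C] (O : Type u) : Type u :=
  Σ X : C ⥤ NatSets.{u}, (X ⋙ natSetsFunctor ⟶ (PDA C O).obj (X ⋙ natSetsFunctor))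

/-- The underlying `PDA`-coalgebra. -/
def SmallCoalg.toCoalg (K : SmallCoalg C O) : CoalgPDA C O := ⟨K.1 ⋙ natSetsFunctor, K.2⟩

/-- Every coalgebra with countable carriers is isomorphic to one on sets of natural numbers. -/
theorem exists_smallCoalg_iso (A : CoalgPDA C O) (hA : ∀ i, Countable (A.V.obj i)) :
    ∃ K : SmallCoalg C O, Nonempty (K.toCoalg ≅ A) := by
  have h : ∀ i, ∃ s : NatSets.{u}, Nonempty (natSetsFunctor.obj s ≅ A.V.obj i) := fun i => by
    obtain ⟨f, hf⟩ := exists_injective_nat (A.V.obj i)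
    exact ⟨Set.range (ULift.up.{u} ∘ f),
      ⟨(Equiv.ofInjective _ (ULift.up_injective.comp hf)).symm.toIso⟩⟩
  choose s hs using h
  let e := fun i => (hs i).some
  let X : C ⥤ NatSets.{u} :=
    { obj := s
      map := fun {i j} d => InducedCategory.homMk ((e i).hom ≫ A.V.map d ≫ (e j).inv)
      map_id := fun i => by
        ext1
        simp
      map_comp := fun d d' => by
        ext1
        simp }
  let φ : X ⋙ natSetsFunctor ≅ A.V := NatIso.ofComponents e fun d => by simp [X]
  -- The structure map is transported along `φ`, which makes `φ` an isomorphism of coalgebras.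
  refine ⟨⟨X, φ.hom ≫ A.str ≫ (PDA C O).map φ.inv⟩, ⟨Endofunctor.Coalgebra.isoMk φ ?_⟩⟩
  change (φ.hom ≫ A.str ≫ (PDA C O).map φ.inv) ≫ (PDA C O).map φ.hom = φ.hom ≫ A.str
  rw [Category.assoc, Category.assoc, ← Functor.map_comp, φ.inv_hom_id, CategoryTheory.Functor.map_id,
    Category.comp_id]

/-- Every state is bisimilar to a state of a subcoalgebra isomorphic to one on sets of natural
numbers. -/
theorem exists_smallCoalg_bisimilar (A : CoalgPDA C O) {i : C} (p : A.V.obj i) :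
    ∃ K : SmallCoalg C O, IsSubcoalgebra K.toCoalg A ∧
      ∃ q, Bisimilar A K.toCoalg i p q := by
  obtain ⟨S, hc, hS, hp⟩ := exists_countable_closed A ⟨i, p⟩
  have hcount : ∀ i, Countable ((restrictCoalg hS).V.obj i) := fun i =>
    (hc.preimage (sigma_mk_injective (i := i))).to_subtype
  obtain ⟨K, ⟨e⟩⟩ := exists_smallCoalg_iso _ hcount
  refine ⟨K, ⟨e.hom ≫ restrictMap hS, fun j => ?_⟩, e.inv.f.app i ⟨p, hp⟩,
    (bisimilar_app (restrictMap hS) ⟨p, hp⟩).symm.trans (bisimilar_app e.inv _)⟩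
  have h₁ : Mono (e.hom.f.app j) :=
    IsIso.mono_of_iso (((Endofunctor.Coalgebra.forget _).mapIso e).app j).hom
  have h₂ := restrictMap_mono hS j
  exact mono_comp (e.hom.f.app j) ((restrictMap hS).f.app j)

/-- Sums of carriers exist sortwise in sets, and the forgetful functor creates them. -/
instance : HasCoproducts.{u} (CoalgPDA C O) := fun J =>
  have : CreatesColimitsOfShape (Discrete J) (Endofunctor.Coalgebra.forget (PDA C O)) := {}
  hasColimitsOfShape_of_hasColimitsOfShape_createsColimitsOfShape
    (Endofunctor.Coalgebra.forget (PDA C O))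

/-- A covariety of `PDA`-coalgebras has a final object. -/
theorem IsCovariety.hasTerminal {P : ObjectProperty (CoalgPDA C O)} (hP : IsCovariety P) :
    HasTerminal P.FullSubcategory := by
  -- `SmallCoalg` lives in `Type u`, so this family has a small sum.
  let A : {K : SmallCoalg C O // P K.toCoalg} → CoalgPDA C O := fun K => K.1.toCoalg
  have hW : P (∐ A) := hP.sum _ A _ (colimit.isColimit _) fun K => K.2
  have hQ : P (quotientCoalg (∐ A)) := hP.image _ _ _ _ (quotientCoalg_isImage _) hW
  have hex : ∀ B : P.FullSubcategory, Nonempty (B.obj ⟶ quotientCoalg (∐ A)) := fun B =>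
    exists_hom_quotientCoalg fun i b => by
      obtain ⟨K, hK, q, hq⟩ := exists_smallCoalg_bisimilar B.obj b
      -- Closure under subcoalgebras puts `K` among the summands.
      exact ⟨_, hq.trans (bisimilar_app (Sigma.ι A ⟨K, hP.sub _ _ hK B.property⟩) q)⟩
  exact (IsTerminal.ofUniqueHom (Y := (⟨quotientCoalg (∐ A), hQ⟩ : P.FullSubcategory))
    (fun B => P.homMk (hex B).some)
    fun B f => P.hom_ext (quotientCoalg_hom_ext _ _)).hasTerminal

/-- The class of all coalgebras is a covariety, so the same construction yields the final
`PDA`-coalgebra. -/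
theorem isCovariety_top : IsCovariety (⊤ : ObjectProperty (CoalgPDA C O)) where
  sub _ _ _ _ := trivial
  image _ _ _ _ _ _ := trivial
  sum _ _ _ _ _ := trivial

theorem hasTerminal_coalgPDA : HasTerminal (CoalgPDA C O) :=
  have := (isCovariety_top (C := C) (O := O)).hasTerminal
  hasTerminal_of_equivalence (ObjectProperty.topEquivalence (CoalgPDA C O)).inverse

/-- The kernel of the final morphism in a class closed under homomorphic images is
bisimilarity. -/
theorem from_eq_iff_bisimilar {P : ObjectProperty (CoalgPDA C O)}
    (hP : ∀ (A B : CoalgPDA C O) (h : A ⟶ B) (J : CoalgPDA C O),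
      IsHomomorphicImage h J → P A → P J)
    {Z : P.FullSubcategory} (hZ : IsTerminal Z) (A : P.FullSubcategory) {i : C}
    (x y : A.obj.V.obj i) :
    (hZ.from A).hom.f.app i x = (hZ.from A).hom.f.app i y ↔ Bisimilar A.obj A.obj i x y := by
  refine ⟨bisimilar_of_app_eq, fun h => ?_⟩
  let Q : P.FullSubcategory :=
    ⟨quotientCoalg A.obj, hP _ _ _ _ (quotientCoalg_isImage A.obj) A.property⟩
  let π : A ⟶ Q := P.homMk (quotientMap A.obj)
  -- The quotient lies in the class, so by uniqueness the final morphism factors through the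
  -- projection, which identifies bisimilar states.
  rw [← hZ.hom_ext (π ≫ hZ.from Q) (hZ.from A)]
  exact congrArg ((hZ.from Q).hom.f.app i) (quotientMap_eq_iff.2 h)

/-- The kernel of the final morphism of `PDA`-coalgebras is bisimilarity. -/
theorem from_eq_iff_bisimilar_coalgPDA {F : CoalgPDA C O} (hF : IsTerminal F)
    (A : CoalgPDA C O) {i : C} (x y : A.V.obj i) :
    (hF.from A).f.app i x = (hF.from A).f.app i y ↔ Bisimilar A A i x y := by
  refine ⟨bisimilar_of_app_eq, fun h => ?_⟩
  rw [← hF.hom_ext (quotientMap A ≫ hF.from _) (hF.from A)]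
  exact congrArg ((hF.from (quotientCoalg A)).f.app i) (quotientMap_eq_iff.2 h)

/-! ### Coalgebras satisfying an inference system -/

variable (T : Set (Rule C O))

theorem incl_app_injective (X : C ⥤ Type u) (i : C) :
    Function.Injective (((incl T).app X).app i) :=
  Subtype.val_injective

instance (X : C ⥤ Type u) : Mono ((incl T).app X) :=
  have : ∀ i, Mono (((incl T).app X).app i) := fun i =>
    (mono_iff_injective _).2 (incl_app_injective T X i)
  NatTrans.mono_of_mono_app _

/-- A derivation through `d` to `t'` is one through the identity to `t'.pre d`, and `t'` belongs to
`d(p)` exactly when `t'.pre d` belongs to `p`. Thus only saturation of each transition set matters.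
-/
theorem factors_iff_satisfies (A : CoalgPDA C O) : Factors T A ↔ Satisfies T A := by
  constructor
  · rintro ⟨α', hα⟩ i k d p t t' ht hd
    have hp : outgoing A p = (show PS T A.V i from α'.app i p).1.1 := by
      unfold outgoing
      rw [← hα]
      rfl
    rw [mem_outgoing_map, hp]
    rw [hp] at ht
    exact (show PS T A.V i from α'.app i p).2 t ht _ (deriv_pre_iff.2 hd)
  · intro h
    have hsat : ∀ (i : C) (p : A.V.obj i), IsSaturated T A.V (outgoing A p) := by
      intro i p t₁ ht₁ t₂ hd
      have := h (𝟙 i) p t₁ t₂ ht₁ hd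
      rwa [Functor.map_id_apply] at this
    refine ⟨
      { app := fun i => ↾(fun p => (⟨A.str.app i p, hsat i p⟩ : PS T A.V i))
        naturality := fun i k d => ?_ }, ?_⟩
    · ext p
      -- After the injective inclusion, naturality of the factor is naturality of `A.str`.
      apply incl_app_injective T A.V k
      have h₁ := NatTrans.naturality_apply A.str d p
      have h₂ := NatTrans.naturality_apply ((incl T).app A.V) d
        (show ((ST T).obj A.V).obj i from (⟨A.str.app i p, hsat i p⟩ : PS T A.V i))
      exact h₁.trans h₂.symm
    · ext i p
      rfl

/-- A coalgebra covered by images of coalgebras satisfying `T` satisfies `T`. -/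
theorem satisfies_of_cover {B : CoalgPDA C O}
    (h : ∀ (i : C) (b : B.V.obj i), ∃ (A : CoalgPDA C O) (f : A ⟶ B) (a : A.V.obj i),
      Satisfies T A ∧ f.f.app i a = b) : Satisfies T B := by
  rintro i k d b ⟨j, c, o, l, y⟩ ⟨j', c', o', l', y'⟩ ht ⟨e, e', he, hT, hy⟩
  obtain ⟨A, f, a, hA, rfl⟩ := h i b
  rw [outgoing_app, mem_image_transitionMap] at ht
  obtain ⟨x, hx, rfl⟩ := ht
  -- A derivation acts on the target only through the operator `e'`, so it lifts from `f(x)` to `x`.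
  have h' := hA d a ⟨j, c, o, l, x⟩ ⟨j', c', o', l', A.V.map e' x⟩ hx ⟨e, e', he, hT, rfl⟩
  have hd := NatTrans.naturality_apply f.f d a
  have hx' := NatTrans.naturality_apply f.f e' x
  rw [← hd, outgoing_app, mem_image_transitionMap]
  exact ⟨_, h', hx'.trans hy⟩

/-- The legs of a sum of `PDA`-coalgebras are jointly surjective. -/
theorem cofan_jointly_surjective {K : Type u} {A : K → CoalgPDA C O} {c : Cofan A}
    (hc : IsColimit c) {i : C} (x : c.pt.V.obj i) :
    ∃ (k : K) (a : (A k).V.obj i), (c.inj k).f.app i a = x := by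
  -- Forgetting the structure and evaluating at a sort both preserve sums, which reduces the claim
  -- to a sum of sets.
  let G := Endofunctor.Coalgebra.forget (PDA C O) ⋙ (evaluation C (Type u)).obj i
  obtain ⟨⟨k⟩, a, ha⟩ := Types.jointly_surjective _ (isColimitOfPreserves G hc) x
  exact ⟨k, a, ha⟩

/-- For a subcoalgebra the derivation is carried out in `B`, and injectivity brings the derived
triple back. Images and sums are covered by morphisms from coalgebras satisfying `T`. -/
theorem isCovariety_satisfies : IsCovariety (Satisfies T) where
  sub A B := by
    rintro ⟨m, hm⟩ hB i k d p ⟨j, c, o, l, x⟩ ⟨j', c', o', l', x'⟩ ht ⟨e, e', he, hT, hx⟩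
    have hx' := NatTrans.naturality_apply m.f e' x
    have h := hB d (m.f.app i p) ⟨j, c, o, l, m.f.app l x⟩ ⟨j', c', o', l', m.f.app l' x'⟩
      (by
        rw [outgoing_app]
        exact ⟨_, ht, rfl⟩)
      ⟨e, e', he, hT, hx'.symm.trans (congrArg (m.f.app l') hx)⟩
    have hd := NatTrans.naturality_apply m.f d p
    rw [← hd, outgoing_app, mem_image_transitionMap] at h
    obtain ⟨z, hz, hzx⟩ := h
    rwa [(mono_iff_injective _).1 (hm l') hzx] at hz
  image A B h J := by
    rintro ⟨e, m, he, -, -⟩ hA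
    refine satisfies_of_cover T fun i b => ?_
    obtain ⟨a, ha⟩ := (epi_iff_surjective _).1 (he i) b
    exact ⟨A, e, a, hA, ha⟩
  sum K A c hc hA := satisfies_of_cover T fun i b => by
    obtain ⟨k, a, ha⟩ := cofan_jointly_surjective hc b
    exact ⟨A k, c.inj k, a, hA k, ha⟩

theorem isCovariety_factors : IsCovariety (Factors T) := by
  rw [show Factors T = Satisfies T from funext fun A => propext (factors_iff_satisfies T A)]
  exact isCovariety_satisfies T

/-! ### The isomorphism between `S_T`-coalgebras and coalgebras factoring through `ι` -/

/-- The inverse of `toCoalgPDAI`: it factors structure maps through `ι`. -/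
noncomputable def ofCoalgPDAI : CoalgPDAI T ⥤ CoalgST T where
  obj A := ⟨A.obj.V, A.property.choose⟩
  map {A B} f :=
    { f := f.hom.f
      h := by
        -- After composition with the mono `ι`, the square is the one for the `PDA`-morphism `f`.
        rw [← cancel_mono ((incl T).app B.obj.V), Category.assoc, Category.assoc,
          (incl T).naturality, reassoc_of% A.property.choose_spec, B.property.choose_spec]
        exact f.hom.h }

theorem toCoalgPDAI_comp_ofCoalgPDAI : toCoalgPDAI T ⋙ ofCoalgPDAI T = 𝟭 _ := by
  have hs : ∀ A : CoalgST T, ((toCoalgPDAI T).obj A).property.choose = A.str := fun A =>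
    (cancel_mono ((incl T).app A.V)).1 ((toCoalgPDAI T).obj A).property.choose_spec
  have hobj : ∀ A : CoalgST T, (toCoalgPDAI T ⋙ ofCoalgPDAI T).obj A = A := fun A =>
    congrArg (Endofunctor.Coalgebra.mk A.V) (hs A)
  refine Functor.hext hobj fun A B f => ?_
  -- With the structure maps as variables, substitution makes the endpoints of the two morphisms
  -- literally equal.
  have key : ∀ (α : A.V ⟶ (ST T).obj A.V) (β : B.V ⟶ (ST T).obj B.V)
      (h : α ≫ (ST T).map f.f = f.f ≫ β), α = A.str → β = B.str →
      (⟨f.f, h⟩ : (⟨A.V, α⟩ : CoalgST T) ⟶ ⟨B.V, β⟩) ≍ f := by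
    rintro _ _ _ rfl rfl
    rfl
  exact key _ _ _ (hs A) (hs B)

theorem ofCoalgPDAI_comp_toCoalgPDAI : ofCoalgPDAI T ⋙ toCoalgPDAI T = 𝟭 _ := by
  have hs : ∀ A : CoalgPDAI T, A.property.choose ≫ (incl T).app A.obj.V = A.obj.str := fun A =>
    A.property.choose_spec
  have key₀ : ∀ (A : CoalgPDAI T) (α : A.obj.V ⟶ (PDA C O).obj A.obj.V)
      (h : Factors T ⟨A.obj.V, α⟩), α = A.obj.str → (⟨⟨A.obj.V, α⟩, h⟩ : CoalgPDAI T) = A := by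
    rintro A _ _ rfl
    rfl
  refine Functor.hext (fun A => key₀ A _ _ (hs A)) fun A B f => ?_
  have key : ∀ (α : A.obj.V ⟶ (PDA C O).obj A.obj.V) (β : B.obj.V ⟶ (PDA C O).obj B.obj.V)
      (hα : Factors T ⟨A.obj.V, α⟩) (hβ : Factors T ⟨B.obj.V, β⟩)
      (h : α ≫ (PDA C O).map f.hom.f = f.hom.f ≫ β), α = A.obj.str → β = B.obj.str →
      ((Factors T).homMk ⟨f.hom.f, h⟩ :
        (⟨⟨A.obj.V, α⟩, hα⟩ : CoalgPDAI T) ⟶ ⟨⟨B.obj.V, β⟩, hβ⟩) ≍ f := by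
    rintro _ _ _ _ _ rfl rfl
    rfl
  exact key _ _ _ _ _ (hs A) (hs B)

/-- The equivalence between `S_T`-coalgebras and coalgebras factoring through `ι`. -/
noncomputable def coalgSTEquivalence : CoalgST T ≌ CoalgPDAI T :=
  CategoryTheory.Equivalence.mk (toCoalgPDAI T) (ofCoalgPDAI T)
    (eqToIso (toCoalgPDAI_comp_ofCoalgPDAI T).symm) (eqToIso (ofCoalgPDAI_comp_toCoalgPDAI T))

theorem hasTerminal_coalgPDAI : HasTerminal (CoalgPDAI T) :=
  (isCovariety_factors T).hasTerminal

theorem hasTerminal_coalgST : HasTerminal (CoalgST T) :=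
  have := hasTerminal_coalgPDAI T
  hasTerminal_of_equivalence (coalgSTEquivalence T).functor

/-- The kernel of the final morphism of `S_T`-coalgebras is bisimilarity of the underlying
`PDA`-coalgebra. -/
theorem from_eq_iff_bisimilar_coalgST {Z : CoalgST T} (hZ : IsTerminal Z) (A : CoalgST T)
    {i : C} (x y : A.V.obj i) :
    (hZ.from A).f.app i x = (hZ.from A).f.app i y ↔
      Bisimilar ((inclCoalg T).obj A) ((inclCoalg T).obj A) i x y := by
  have hZ' : IsTerminal ((toCoalgPDAI T).obj Z) :=
    hZ.isTerminalObj (coalgSTEquivalence T).functor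
  -- The equivalence preserves final objects and leaves underlying maps unchanged, so the kernel can
  -- be read off in `CoalgPDAI T`.
  have h : (toCoalgPDAI T).map (hZ.from A) = hZ'.from ((toCoalgPDAI T).obj A) := hZ'.hom_ext _ _
  have := from_eq_iff_bisimilar (isCovariety_factors T).image hZ' ((toCoalgPDAI T).obj A) x y
  rw [← h] at this
  exact this

/-! ### Context interactive systems -/

variable {T}

/-- Bisimilarity in the saturated coalgebra of a system is saturated bisimilarity. -/
theorem bisimilar_satCoalg_iff (I : CIS C O) (hI : I.CountableDegree) {i : C}
    (p q : I.alg.obj i) :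
    Bisimilar (I.satCoalg hI) (I.satCoalg hI) i p q ↔ I.SatBisim p q := by
  constructor
  · intro h
    have hb := isBisimulation_bisimilar (I.satCoalg hI) (I.satCoalg hI)
    refine ⟨Bisimilar (I.satCoalg hI) (I.satCoalg hI), ⟨fun _ _ _ h => h.symm,
      fun _ _ c _ _ h => hb.map c h, fun i p q h o k p' ht => ?_⟩, h⟩
    -- Transitions of the system are those of the coalgebra with identity context.
    have hid : ∀ (r : I.alg.obj i) (r' : I.alg.obj k),
        (⟨i, 𝟙 i, o, ⟨k, r'⟩⟩ : Transition O I.alg.obj i) ∈ outgoing (I.satCoalg hI) r ↔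
          ((⟨i, r⟩ : Elements I.alg.obj), o, (⟨k, r'⟩ : Elements I.alg.obj)) ∈ I.tr := by
      intro r r'
      change ((⟨i, I.alg.map (𝟙 i) r⟩ : Elements I.alg.obj), o, _) ∈ I.tr ↔ _
      rw [Functor.map_id_apply]
    obtain ⟨q', hq, hr⟩ := hb.forth h ((hid p p').2 ht)
    exact ⟨q', (hid q q').1 hq, hr⟩
  · rintro ⟨R, ⟨hsymm, hmap, htr⟩, h⟩
    refine ⟨R, ⟨fun d _ _ h => hmap _ _ d _ _ h, ?_, ?_⟩, h⟩
    · intro i p q h j c o k p' ht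
      -- A transition of `p` with context `c` is one of `c(p)`, and `c(p)`, `c(q)` are again
      -- related.
      exact htr _ _ _ (hmap _ _ c _ _ h) _ _ _ ht
    · intro i p q h j c o k q' ht
      obtain ⟨p', hp, hr⟩ := htr _ _ _ (hmap _ _ c _ _ (hsymm _ _ _ h)) _ _ _ ht
      exact ⟨p', hp, hsymm _ _ _ hr⟩

/-- Used for the composite of `α'` with `ι`, which equals the structure map of the saturated
coalgebra only by hypothesis. -/
theorem bisimilar_iff_of_str_eq (I : CIS C O) (hI : I.CountableDegree)
    {s : I.alg ⟶ (PDA C O).obj I.alg} (hs : s = (I.satCoalg hI).str) {i : C}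
    (p q : I.alg.obj i) :
    Bisimilar (⟨I.alg, s⟩ : CoalgPDA C O) ⟨I.alg, s⟩ i p q ↔ I.SatBisim p q := by
  subst hs
  exact bisimilar_satCoalg_iff I hI p q

end SatCoalg


/-! ### Saturated coalgebras and their final semantics -/

theorem mainTheorem3 {C : Type u} [SmallCategory C] [CountableCategory C] {O : Type u}
    (T : Set (SatCoalg.Rule C O)) :
    -- membership in `Coalg(PDA^I)` is satisfaction of `T`
    (∀ A : SatCoalg.CoalgPDA C O, SatCoalg.Factors T A ↔ SatCoalg.Satisfies T A) ∧
    -- homomorphic images and sums exist, and the coalgebras satisfying `T` form a covariety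
    (∀ (A B : SatCoalg.CoalgPDA C O) (h : A ⟶ B), ∃ J, SatCoalg.IsHomomorphicImage h J) ∧
    HasCoproducts.{u} (SatCoalg.CoalgPDA C O) ∧
    SatCoalg.IsCovariety (SatCoalg.Satisfies T) ∧
    -- `I` is an isomorphism of categories from `Coalg(S_T)` to `Coalg(PDA^I)`
    (∃ G : SatCoalg.CoalgPDAI T ⥤ SatCoalg.CoalgST T,
      SatCoalg.toCoalgPDAI T ⋙ G = 𝟭 _ ∧ G ⋙ SatCoalg.toCoalgPDAI T = 𝟭 _) ∧
    -- final objects exist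
    HasTerminal (SatCoalg.CoalgPDA C O) ∧
    HasTerminal (SatCoalg.CoalgPDAI T) ∧
    HasTerminal (SatCoalg.CoalgST T) ∧
    -- the kernels of the final morphisms coincide
    (∀ (F : SatCoalg.CoalgPDA C O) (hF : IsTerminal F)
      (Z : SatCoalg.CoalgPDAI T) (hZ : IsTerminal Z)
      (A : SatCoalg.CoalgPDAI T) (i : C) (x y : A.obj.V.obj i),
      (hZ.from A).hom.f.app i x = (hZ.from A).hom.f.app i y ↔
        (hF.from A.obj).f.app i x = (hF.from A.obj).f.app i y) ∧
    (∀ (F : SatCoalg.CoalgPDA C O) (hF : IsTerminal F)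
      (Z : SatCoalg.CoalgST T) (hZ : IsTerminal Z)
      (A : SatCoalg.CoalgST T) (i : C) (x y : A.V.obj i),
      (hZ.from A).f.app i x = (hZ.from A).f.app i y ↔
        (hF.from ((SatCoalg.inclCoalg T).obj A)).f.app i x =
          (hF.from ((SatCoalg.inclCoalg T).obj A)).f.app i y) ∧
    -- for a context interactive system these kernels are saturated bisimilarity
    (∀ (I : SatCoalg.CIS C O) (hI : I.CountableDegree),
      (∀ (F : SatCoalg.CoalgPDA C O) (hF : IsTerminal F) (i : C) (p q : I.alg.obj i),
        (hF.from (I.satCoalg hI)).f.app i p = (hF.from (I.satCoalg hI)).f.app i q ↔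
          I.SatBisim p q) ∧
      (SatCoalg.Satisfies T (I.satCoalg hI) →
        (∃! α' : I.alg ⟶ (SatCoalg.ST T).obj I.alg,
          α' ≫ (SatCoalg.incl T).app I.alg = (I.satCoalg hI).str) ∧
        ∀ α' : I.alg ⟶ (SatCoalg.ST T).obj I.alg,
          α' ≫ (SatCoalg.incl T).app I.alg = (I.satCoalg hI).str →
          ∀ (Z : SatCoalg.CoalgST T) (hZ : IsTerminal Z) (i : C) (p q : I.alg.obj i),
            (hZ.from ⟨I.alg, α'⟩).f.app i p = (hZ.from ⟨I.alg, α'⟩).f.app i q ↔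
              I.SatBisim p q)) := by
  open SatCoalg in
  exact ⟨factors_iff_satisfies T, fun _ _ h => exists_isHomomorphicImage h, inferInstance,
    isCovariety_satisfies T,
    ⟨ofCoalgPDAI T, toCoalgPDAI_comp_ofCoalgPDAI T, ofCoalgPDAI_comp_toCoalgPDAI T⟩,
    hasTerminal_coalgPDA, hasTerminal_coalgPDAI T, hasTerminal_coalgST T,
    fun F hF Z hZ A i x y =>
      (from_eq_iff_bisimilar (isCovariety_factors T).image hZ A x y).trans
        (from_eq_iff_bisimilar_coalgPDA hF A.obj x y).symm,
    fun F hF Z hZ A i x y =>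
      (from_eq_iff_bisimilar_coalgST T hZ A x y).trans
        (from_eq_iff_bisimilar_coalgPDA hF ((inclCoalg T).obj A) x y).symm,
    fun I hI => ⟨fun F hF i p q =>
        (from_eq_iff_bisimilar_coalgPDA hF (I.satCoalg hI) p q).trans
          (bisimilar_satCoalg_iff I hI p q),
      fun hT => ⟨by
          obtain ⟨α', h⟩ := (factors_iff_satisfies T _).2 hT
          refine ⟨α', h, fun β hβ => ?_⟩
          exact (cancel_mono ((incl T).app I.alg)).1 (hβ.trans h.symm),
        fun α' h Z hZ i p q =>
          (from_eq_iff_bisimilar_coalgST T hZ ⟨I.alg, α'⟩ p q).trans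
            (bisimilar_iff_of_str_eq I hI h p q)⟩⟩⟩
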